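/- The hypercube $Q_n$ is the graph with vertex set $\{0,1\}^n$ in which two vertices are adjacent if they differ in exactly one coordinate. For graphs $G$ and $H$, $\mathrm{ex}(G,H)$ is the maximum number of edges in a subgraph of $G$ which does not contain a (not necessarily induced) copy of $H$, with the convention that it is $0$ if every subgraph of $G$ contains a copy of $H$; $e(G)$ is the number of edges of $G$. The set of non-zero bits of an edge $xy$ of $Q_l$ is the set of all $i \in [l]$ with $x_i = 1$ or $y_i = 1$ (the positions where both are $1$, together with the one position where $x$ and $y$ differ). A graph $H$ has a $k$-partite representation if there are an $l$, an embedding of $H$ as a (not necessarily induced) subgraph of $Q_l$, and a function $\sigma : [l] \to [k]$ such that every edge of the embedded copy of $H$ has exactly $k$ non-zero bits, and $\sigma$ maps the set of non-zero bits of every such edge bijectively onto $[k]$. Theorem. Let $H$ be a fixed subgraph of the hypercube. If, for some $k$, $H$ has a $k$-partite representation, then \[ \mathrm{ex}(Q_n, H) = o(e(Q_n)) \quad (n \to \infty). \] -/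

import Mathlib

/-- The hypercube `Q_n`: the vertex set is `{0,1}^n`, and two vertices are adjacent if and only if
they differ in exactly one coordinate. -/
def hypercube (n : ℕ) : SimpleGraph (Fin n → Bool) where
  Adj x y := ∃! i, x i ≠ y i
  symm := ⟨fun _ _ ⟨i, hi, h⟩ => ⟨i, Ne.symm hi, fun j hj => h j (Ne.symm hj)⟩⟩
  loopless := ⟨fun _ ⟨_, hi, _⟩ => hi rfl⟩

/-- The set of non-zero bits of the edge of `Q_l` that joins `x` and `y`: the positions of its ones
(where `x` and `y` are both `1`) together with the flip-bit (where exactly one of them is `1`). -/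
def nonzeroBits {l : ℕ} (x y : Fin l → Bool) : Finset (Fin l) :=
  {i | x i = true ∨ y i = true}

/-- `H` has a `k`-partite representation: for some `l`, the graph `H` is (via `φ`) a subgraph of
`Q_l` all of whose edges have exactly `k` non-zero bits, and some `σ : [l] → [k]` maps the set of
non-zero bits of each edge onto `[k]`. -/
def HasPartiteRepresentation {V : Type*} (H : SimpleGraph V) (k : ℕ) : Prop :=
  ∃ (l : ℕ) (φ : H.Copy (hypercube l)) (σ : Fin l → Fin k), ∀ u v : V, H.Adj u v →
    (nonzeroBits (φ u) (φ v)).card = k ∧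
    (nonzeroBits (φ u) (φ v)).image σ = Finset.univ

/-- `ex(G, H)`: the maximum number of edges in a subgraph of the finite graph `G` which does not
contain a copy of `H` (not necessarily induced); it is `0` if there is no such subgraph. -/
noncomputable def exNumber {V W : Type*} [Finite V] (G : SimpleGraph V) (H : SimpleGraph W) : ℕ :=
  sSup {m : ℕ | ∃ G' : G.Subgraph, H.Free G'.coe ∧ G'.edgeSet.ncard = m}

/-! A subgraph `G` of `Q_n` with at least `ε e(Q_n)` edges contains `H`, once `n` is large.

Count each edge at its upper end: on average a vertex `v` has at least `(ε / 2) n` down-directions,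
that is, coordinates that can be lowered along an edge of `G`. By Jensen, a random vertex `v` and a
random `k`-tuple `p` of coordinates have all `p j` among the down-directions of `v` with
probability at least `(ε / 2) ^ k`. Lowering all coordinates `p j` of `v` gives a base `S`, and
`(v, p)` can be recovered from `(S, p)`. Hence some fixed `S` has a positive density of tuples `p`
such that `G` contains the edges down from `S ∪ p` in all the directions `p j` at once
(`exists_base_of_dense`).

These tuples form a dense `k`-uniform hypergraph (tuples with repetitions are negligible), so by
Erdős's theorem it contains a complete `k`-partite hypergraph with `l` points in each part
(`eventually_exists_injective_blowup`, via the supersaturation inequality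
`pow_expect_le_expect_blowup`). If `H ⊆ Q_l` has the partite
representation `σ`, place the coordinate `p` of `Q_l` in the part `σ p`. The non-zero bits of each
edge of `H` then form an edge of the hypergraph, so that the edge itself, shifted by `S`, belongs to
`G` (`exists_embedding_of_blowup`). -/

section
open Finset
open scoped BigOperators

/-! ### Supersaturation for blow-ups of `k`-tuples -/

/-- Jensen's inequality for the uniform average and a natural power. -/
lemma pow_expect_le_expect_pow {ι : Type*} [Fintype ι] [Nonempty ι] (f : ι → ℝ)
    (hf : ∀ i, 0 ≤ f i) (m : ℕ) : (𝔼 i, f i) ^ m ≤ 𝔼 i, f i ^ m := by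
  have h := Real.pow_arith_mean_le_arith_mean_pow univ (fun _ => (Fintype.card ι : ℝ)⁻¹) f
    (fun _ _ => by positivity) (by simp) (fun i _ => hf i) m
  simpa only [Fintype.expect_eq_sum_div_card, ← mul_sum, div_eq_inv_mul] using h

lemma expect_pow_eq_expect_prod {X : Type*} [Fintype X] (f : X → ℝ) (t : ℕ) :
    (𝔼 x, f x) ^ t = 𝔼 p : Fin t → X, ∏ j, f (p j) := by
  simpa using expect_pow univ f t

lemma expect_fin_succ_pi {A : Type*} [Fintype A] {k : ℕ} (f : (Fin (k + 1) → A) → ℝ) :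
    𝔼 z, f z = 𝔼 x, 𝔼 z, f (Fin.cons x z) := by
  rw [← expect_product', univ_product_univ]
  exact (Fintype.expect_equiv (Fin.consEquiv fun _ => A) _ _ fun _ => rfl).symm

/-- Supersaturation for blow-ups, weighted form. If `w` is the indicator of a set of `k`-tuples, the
right-hand side is the density of those families `a` of `k` blocks of `t` points for which every
tuple with one point from each block lies in the set. The induction on `k` splits off one
coordinate and uses Jensen's inequality twice: over the remaining coordinates, then over the first
block. -/
theorem pow_expect_le_expect_blowup {X : Type*} [Fintype X] [Nonempty X] (t k : ℕ)
    (w : (Fin k → X) → ℝ) (hw : ∀ z, 0 ≤ w z) :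
    (𝔼 z, w z) ^ t ^ k ≤
      𝔼 a : Fin k → Fin t → X, ∏ c : Fin k → Fin t, w (fun i => a i (c i)) := by
  induction k with
  | zero =>
    simp only [Fintype.expect_eq_sum_div_card, Fintype.sum_unique, Fintype.prod_unique]
    simp [Subsingleton.elim _ (default : Fin 0 → X)]
  | succ k ih =>
    calc (𝔼 z, w z) ^ t ^ (k + 1)
        = ((𝔼 z, 𝔼 x, w (Fin.cons x z)) ^ t) ^ t ^ k := by
          rw [expect_fin_succ_pi, expect_comm, ← pow_mul, pow_succ']
      _ ≤ (𝔼 z, (𝔼 x, w (Fin.cons x z)) ^ t) ^ t ^ k := by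
          gcongr
          · exact pow_nonneg (expect_nonneg fun z _ => expect_nonneg fun x _ => hw _) _
          · exact pow_expect_le_expect_pow _ (fun z => expect_nonneg fun x _ => hw _) _
      _ = (𝔼 b : Fin t → X, 𝔼 z, ∏ j, w (Fin.cons (b j) z)) ^ t ^ k := by
          congr 1
          exact (expect_congr rfl fun z _ => expect_pow_eq_expect_prod _ t).trans
            (expect_comm _ _ _)
      _ ≤ 𝔼 b : Fin t → X, (𝔼 z, ∏ j, w (Fin.cons (b j) z)) ^ t ^ k :=
          pow_expect_le_expect_pow _
            (fun b => expect_nonneg fun z _ => prod_nonneg fun j _ => hw _) _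
      _ ≤ 𝔼 b : Fin t → X, 𝔼 a : Fin k → Fin t → X, ∏ c : Fin k → Fin t,
            ∏ j, w (Fin.cons (b j) fun i => a i (c i)) := by
          gcongr with b
          exact ih _ fun z => prod_nonneg fun j _ => hw _
      _ = _ := by
          rw [expect_fin_succ_pi]
          refine expect_congr rfl fun b _ => expect_congr rfl fun a _ => ?_
          rw [prod_comm, ← Fintype.prod_prod_type']
          refine Fintype.prod_equiv (Fin.consEquiv fun _ => Fin t) _ _ fun p => ?_
          congr 1
          funext i
          refine Fin.cases ?_ (fun i => ?_) i <;> simp [Fin.consEquiv]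

/-- Erdős's theorem on complete `k`-partite `k`-uniform hypergraphs: a set of `k`-tuples of density
`δ` contains all transversals of some `k` disjoint blocks of `t` points each, once `n` is large. A
positive proportion of all families `a` are blow-ups inside the set, whereas the proportion of
non-injective families tends to `0`. -/
theorem eventually_exists_injective_blowup (t k : ℕ) {δ : ℝ} (hδ : 0 < δ) :
    ∀ᶠ n : ℕ in Filter.atTop, ∀ P : (Fin k → Fin n) → Prop, ∀ [DecidablePred P],
      δ ≤ 𝔼 z, (if P z then (1 : ℝ) else 0) →
      ∃ a : Fin k → Fin t → Fin n, Function.Injective (Function.uncurry a) ∧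
        ∀ c : Fin k → Fin t, P fun i => a i (c i) := by
  have hlim : Filter.Tendsto (fun n : ℕ => (n.descFactorial (k * t) : ℝ) / (n : ℝ) ^ (k * t))
      Filter.atTop (nhds 1) := by
    refine (Asymptotics.isEquivalent_iff_tendsto_one ?_).1
      (isEquivalent_descFactorial (k * t))
    filter_upwards [Filter.eventually_gt_atTop 0] with n hn
    positivity
  have hη : 1 - δ ^ t ^ k < 1 := by linarith [pow_pos hδ (t ^ k)]
  filter_upwards [hlim.eventually_const_lt hη, Filter.eventually_gt_atTop 0] with n hn hn0 P _ hP
  by_contra! hno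
  have : Nonempty (Fin n) := ⟨⟨0, hn0⟩⟩
  classical
  have hpos : (0 : ℝ) < (n : ℝ) ^ (k * t) := by positivity
  have hblow := (pow_le_pow_left₀ hδ.le hP (t ^ k)).trans
    (pow_expect_le_expect_blowup t k _ fun z => by split_ifs <;> norm_num)
  -- A non-injective family contributes at most `1`, and by assumption an injective one nothing.
  have hprod (a : Fin k → Fin t → Fin n) :
      ∏ c : Fin k → Fin t, (if P fun i => a i (c i) then (1 : ℝ) else 0) ≤
        1 - if Function.Injective (Function.uncurry a) then 1 else 0 := by
    split_ifs with ha
    · obtain ⟨c, hc⟩ := hno a ha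
      rw [prod_eq_zero (mem_univ c) (if_neg hc), sub_self]
    · rw [sub_zero]
      exact prod_le_one (fun _ _ => by split_ifs <;> norm_num)
        fun _ _ => by split_ifs <;> norm_num
  have hcard : #{a : Fin k → Fin t → Fin n | Function.Injective (Function.uncurry a)} =
      n.descFactorial (k * t) := by
    have h := Fintype.card_embedding_eq (α := Fin k × Fin t) (β := Fin n)
    simp only [Fintype.card_prod, Fintype.card_fin] at h
    rw [← h, ← Fintype.card_subtype]
    refine Fintype.card_congr (((Equiv.curry _ _ _).symm.subtypeEquiv fun a => ?_).trans
      (Equiv.subtypeInjectiveEquivEmbedding _ _))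
    rfl
  have hle := hblow.trans (expect_le_expect fun a _ => hprod a)
  rw [expect_sub_distrib, Fintype.expect_one, Fintype.expect_eq_sum_div_card, sum_boole,
    hcard] at hle
  simp only [Fintype.card_pi, Fintype.card_fin, prod_const, card_univ, ← pow_mul,
    Nat.cast_pow, mul_comm t k] at hle
  linarith

/-! ### Stars above a common base -/

/-- The vertex obtained from `S` by setting all coordinates in the range of `p` to `1`. -/
def addOnes {n : ℕ} {ι : Type*} [Fintype ι] (S : Fin n → Bool) (p : ι → Fin n) : Fin n → Bool :=
  fun q => S q || decide (∃ j, p j = q)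

/-- The coordinates `p j` are all `0` in the vertex `S`, and after they have been raised to `1`,
the graph `Γ` contains every edge that lowers a single one of them again. These edges form a star
whose centre is `addOnes S p`. Repetitions in `p` are allowed. -/
def IsStar {n k : ℕ} (Γ : SimpleGraph (Fin n → Bool)) (S : Fin n → Bool)
    (p : Fin k → Fin n) : Prop :=
  ∀ j, S (p j) = false ∧ Γ.Adj (addOnes S p) (Function.update (addOnes S p) (p j) false)

/-- The coordinates of `v` that are `1` and whose change to `0` is along an edge of `Γ`. -/
def downDirections {n : ℕ} (Γ : SimpleGraph (Fin n → Bool)) [DecidableRel Γ.Adj]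
    (v : Fin n → Bool) : Finset (Fin n) :=
  {i | v i = true ∧ Γ.Adj v (Function.update v i false)}

/-- Removing the coordinates in the range of `p` from `v` gives a base `S` from which `v` is
recovered as `addOnes S p`; hence this removal is injective. -/
lemma card_downDirections_le_card_isStar {n k : ℕ} (Γ : SimpleGraph (Fin n → Bool))
    [DecidableRel Γ.Adj] (p : Fin k → Fin n) [DecidablePred fun S => IsStar Γ S p] :
    #{v : Fin n → Bool | ∀ j, p j ∈ downDirections Γ v} ≤ #{S | IsStar Γ S p} := by
  have key (v : Fin n → Bool) (hv : ∀ j, p j ∈ downDirections Γ v) :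
      addOnes (fun q => v q && !decide (∃ j, p j = q)) p = v := by
    funext q
    by_cases hq : ∃ j, p j = q
    · obtain ⟨j, rfl⟩ := hq
      have := (mem_filter.1 (hv j)).2.1
      simp [addOnes, this]
    · simp [addOnes, hq]
  refine card_le_card_of_injOn (fun v q => v q && !decide (∃ j, p j = q)) ?_ ?_
  · intro v hv
    have hv' : ∀ j, p j ∈ downDirections Γ v := by simpa using hv
    have hstar : IsStar Γ (fun q => v q && !decide (∃ j, p j = q)) p := by
      intro j
      rw [key v hv']
      exact ⟨by simp, (mem_filter.1 (hv' j)).2.2⟩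
    simpa using hstar
  · intro v hv v' hv' h
    rw [← key v (by simpa using hv), ← key v' (by simpa using hv')]
    exact congrArg (addOnes · p) h

/-- In a subgraph of positive density, some base `S` has a positive density of stars above it. By
Jensen, a positive proportion of pairs `(v, p)` have all `p j` among the down-directions of `v`;
reparametrise them by `(S, p)` and choose the best `S`. -/
theorem exists_base_of_dense {n : ℕ} (hn : 0 < n) (k : ℕ) (Γ : SimpleGraph (Fin n → Bool))
    [DecidableRel Γ.Adj] [∀ S : Fin n → Bool, DecidablePred fun p : Fin k → Fin n => IsStar Γ S p]
    {δ : ℝ} (hδ : 0 ≤ δ) (hΓ : δ * (n * 2 ^ n) ≤ ∑ v, (#(downDirections Γ v) : ℝ)) :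
    ∃ S : Fin n → Bool, δ ^ k ≤ 𝔼 p : Fin k → Fin n, (if IsStar Γ S p then (1 : ℝ) else 0) := by
  have : Nonempty (Fin n) := ⟨⟨0, hn⟩⟩
  have havg : δ ≤ 𝔼 v, 𝔼 i, (if i ∈ downDirections Γ v then (1 : ℝ) else 0) := by
    simp only [Fintype.expect_eq_sum_div_card, sum_boole, ← sum_div, filter_univ_mem]
    simp only [Fintype.card_fin, Fintype.card_pi, Fintype.card_bool, prod_const, card_univ]
    rw [div_div, le_div_iff₀ (by positivity)]
    simpa using hΓ
  have h : δ ^ k ≤ 𝔼 S, 𝔼 p : Fin k → Fin n, (if IsStar Γ S p then (1 : ℝ) else 0) :=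
    calc δ ^ k ≤ (𝔼 v, 𝔼 i, (if i ∈ downDirections Γ v then (1 : ℝ) else 0)) ^ k := by gcongr
      _ ≤ 𝔼 v, (𝔼 i, (if i ∈ downDirections Γ v then (1 : ℝ) else 0)) ^ k :=
          pow_expect_le_expect_pow _
            (fun v => expect_nonneg fun i _ => by split_ifs <;> norm_num) _
      _ = 𝔼 p : Fin k → Fin n, 𝔼 v, ∏ j, (if p j ∈ downDirections Γ v then (1 : ℝ) else 0) := by
          simp only [expect_pow_eq_expect_prod]
          rw [expect_comm]
      _ ≤ 𝔼 p : Fin k → Fin n, 𝔼 S, (if IsStar Γ S p then (1 : ℝ) else 0) := by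
          refine expect_le_expect fun p _ => ?_
          simp only [prod_boole, mem_univ, true_implies, Fintype.expect_eq_sum_div_card,
            sum_boole]
          refine div_le_div_of_nonneg_right ?_ (Nat.cast_nonneg _)
          exact_mod_cast card_downDirections_le_card_isStar Γ p
      _ = _ := expect_comm _ _ _
  obtain ⟨S, -, hS⟩ := exists_le_of_le_expect univ_nonempty h
  exact ⟨S, hS⟩

/-! ### Edges of subgraphs of the hypercube -/

lemma hypercube_adj_update_false {n : ℕ} {v : Fin n → Bool} {i : Fin n} (hv : v i = true) :
    (hypercube n).Adj v (Function.update v i false) := by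
  refine ⟨i, by simp [hv], fun j hj => ?_⟩
  by_contra hne
  exact hj (by simp [hne])

/-- An edge of the hypercube joins a vertex to the one obtained by lowering one of its ones. -/
lemma hypercube_adj_cases {n : ℕ} {x y : Fin n → Bool} (h : (hypercube n).Adj x y) :
    ∃ i, (x i = true ∧ y = Function.update x i false) ∨
      (y i = true ∧ x = Function.update y i false) := by
  obtain ⟨i, hi, huniq⟩ := h
  have hrest (j : Fin n) (hj : j ≠ i) : x j = y j := by
    by_contra hne
    exact hj (huniq j hne)
  refine ⟨i, ?_⟩
  rw [Function.eq_update_iff, Function.eq_update_iff]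
  cases hx : x i <;> cases hy : y i <;> simp_all

lemma update_false_edge_injective {n : ℕ} {v v' : Fin n → Bool} {i i' : Fin n}
    (hv : v i = true) (hv' : v' i' = true)
    (h : s(v, Function.update v i false) = s(v', Function.update v' i' false)) :
    v = v' ∧ i = i' := by
  have hi (u : Fin n → Bool) (h : Function.update u i false = Function.update u i' false)
      (hu : u i = true) : i = i' := by
    by_contra hne
    have := congrFun h i
    simp [hne, hu] at this
  rw [Sym2.eq_iff] at h
  obtain ⟨rfl, h⟩ | ⟨h₁, h₂⟩ := h
  · exact ⟨rfl, hi v h hv⟩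
  · rw [h₁] at hv
    have := congrFun h₂ i
    by_cases hne : i = i'
    · subst hne; simp at hv
    · simp [hne] at hv this
      simp [hv] at this

/-- Each edge is counted once, at its upper end. -/
lemma ncard_edgeSet_eq_sum_downDirections {n : ℕ} (Γ : SimpleGraph (Fin n → Bool))
    [DecidableRel Γ.Adj] (hΓ : Γ ≤ hypercube n) :
    Γ.edgeSet.ncard = ∑ v, #(downDirections Γ v) := by
  rw [← card_sigma, ← Set.ncard_coe_finset]
  refine (Set.ncard_congr (fun z _ => s(z.1, Function.update z.1 z.2 false)) ?_ ?_ ?_).symm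
  · rintro ⟨v, i⟩ hz
    exact (by simpa [downDirections] using hz : v i = true ∧ _).2
  · rintro ⟨v, i⟩ ⟨v', i'⟩ hz hz' h
    obtain ⟨rfl, rfl⟩ := update_false_edge_injective
      (by simpa [downDirections] using hz : v i = true ∧ _).1
      (by simpa [downDirections] using hz' : v' i' = true ∧ _).1 h
    rfl
  · intro e he
    induction e with | _ x y =>
    obtain ⟨i, ⟨hx, rfl⟩ | ⟨hy, rfl⟩⟩ := hypercube_adj_cases (show (hypercube n).Adj x y from hΓ he)
    · exact ⟨⟨x, i⟩, by simpa [downDirections, hx] using he, rfl⟩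
    · exact ⟨⟨y, i⟩, by simpa [downDirections, hy] using (show Γ.Adj _ _ from he).symm, Sym2.eq_swap⟩

lemma two_mul_ncard_edgeSet_hypercube (n : ℕ) :
    2 * (hypercube n).edgeSet.ncard = n * 2 ^ n := by
  classical
  have hswap (i : Fin n) : #{v : Fin n → Bool | v i = true} = #{v : Fin n → Bool | ¬ v i = true} := by
    refine card_nbij' (fun v => Function.update v i false) (fun v => Function.update v i true)
      ?_ ?_ ?_ ?_
    · intro v _; simp
    · intro v _; simp
    · intro v hv
      have hv : v i = true := by simpa using hv
      simp [← hv]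
    · intro v hv
      have hv : v i = false := by simpa using hv
      simp [← hv]
  have hdown (v : Fin n → Bool) : downDirections (hypercube n) v = ({i | v i = true} : Finset _) :=
    filter_congr fun i _ => and_iff_left_of_imp hypercube_adj_update_false
  rw [ncard_edgeSet_eq_sum_downDirections _ le_rfl]
  simp only [hdown, card_filter _ univ]
  rw [sum_comm]
  simp only [← card_filter]
  rw [mul_sum]
  have (i : Fin n) : 2 * #{v : Fin n → Bool | v i = true} = 2 ^ n := by
    have h := card_filter_add_card_filter_not (s := (univ : Finset (Fin n → Bool)))
      (fun v => v i = true)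
    rw [← hswap i] at h
    simp only [card_univ, Fintype.card_pi, Fintype.card_bool, prod_const, Fintype.card_fin] at h
    omega
  simp [this]

/-! ### Embedding `H` -/

/-- A blow-up of stars above `S` contains a copy of `H`. The coordinate `p` of `Q_l` is sent to the
`p`-th point of the block `σ p`, and every vertex is raised by `S`. The non-zero bits of an edge of
`H` meet each fibre of `σ` exactly once, so they become a transversal of the blocks, and the edge
becomes one of the edges of the corresponding star. -/
theorem exists_embedding_of_blowup {V : Type*} {H : SimpleGraph V} {n l k : ℕ}
    (φ : H.Copy (hypercube l)) (σ : Fin l → Fin k)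
    (hσ : ∀ u v : V, H.Adj u v → (nonzeroBits (φ u) (φ v)).card = k ∧
      (nonzeroBits (φ u) (φ v)).image σ = univ)
    (Γ : SimpleGraph (Fin n → Bool)) (S : Fin n → Bool) (a : Fin k → Fin l → Fin n)
    (ha : Function.Injective (Function.uncurry a))
    (hstar : ∀ c : Fin k → Fin l, IsStar Γ S fun i => a i (c i)) :
    ∃ g : V → Fin n → Bool, Function.Injective g ∧ ∀ u v, H.Adj u v → Γ.Adj (g u) (g v) := by
  set f : Fin l → Fin n := fun p => a (σ p) p with hf
  have hfinj : Function.Injective f := fun p q h => congrArg Prod.snd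
    (ha (a₁ := (σ p, p)) (a₂ := (σ q, q)) h)
  have hS (p : Fin l) : S (f p) = false := (hstar (fun _ => p) (σ p)).1
  set ψ : (Fin l → Bool) → Fin n → Bool := fun x => addOnes S fun p : {p // x p = true} => f p
    with hψ
  have hψf (x : Fin l → Bool) (p : Fin l) : ψ x (f p) = x p := by
    simp [hψ, addOnes, hS, hfinj.eq_iff]
  have hψout (x : Fin l → Bool) (q : Fin n) (hq : ∀ p, f p ≠ q) : ψ x q = S q := by
    simp [hψ, addOnes, hq]
  have hψinj : Function.Injective ψ := fun x y h => funext fun p => by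
    rw [← hψf x, ← hψf y, h]
  have hψupdate (x : Fin l → Bool) (i : Fin l) :
      ψ (Function.update x i false) = Function.update (ψ x) (f i) false := by
    funext q
    by_cases hq : ∃ p, f p = q
    · obtain ⟨p, rfl⟩ := hq
      rw [hψf]
      by_cases hp : p = i
      · subst hp; simp
      · rw [Function.update_of_ne hp, Function.update_of_ne (hfinj.ne hp), hψf]
    · push Not at hq
      rw [hψout _ _ hq, Function.update_of_ne (hq i).symm, hψout _ _ hq]
  have hdown (x : Fin l → Bool) (i : Fin l) (hi : x i = true)
      (hcard : #(nonzeroBits x (Function.update x i false)) = k)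
      (himage : (nonzeroBits x (Function.update x i false)).image σ = univ) :
      Γ.Adj (ψ x) (ψ (Function.update x i false)) := by
    have hN : nonzeroBits x (Function.update x i false) =
        ({p | x p = true} : Finset (Fin l)) := by
      ext p
      by_cases hp : p = i
      · subst hp; simp [nonzeroBits, hi]
      · simp [nonzeroBits, hp]
    rw [hN] at hcard himage
    have hinj : Set.InjOn σ ({p | x p = true} : Finset (Fin l)) :=
      card_image_iff.1 (by rw [himage, hcard, card_univ, Fintype.card_fin])
    have hex (j : Fin k) : ∃ p, x p = true ∧ σ p = j := by
      have : j ∈ ({p | x p = true} : Finset (Fin l)).image σ := himage ▸ mem_univ j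
      simpa using this
    choose c hcx hcσ using hex
    have hcinv (p : Fin l) (hp : x p = true) : c (σ p) = p :=
      hinj (by simpa using hcx (σ p)) (by simpa using hp) (hcσ _)
    have hac (j : Fin k) : a j (c j) = f (c j) := by simp only [hf, hcσ]
    have hψx : addOnes S (fun j => a j (c j)) = ψ x := by
      funext q
      simp only [hψ, addOnes, hac]
      congr 2
      refine propext ⟨?_, ?_⟩
      · rintro ⟨j, hj⟩
        exact ⟨⟨c j, hcx j⟩, hj⟩
      · rintro ⟨⟨p, hp⟩, hpq⟩
        exact ⟨σ p, by rw [hcinv p hp]; exact hpq⟩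
    -- The star over the transversal `c` has centre `ψ x`; its edge in block `σ i` lowers `f i`.
    have h := (hstar c (σ i)).2
    rw [hψx] at h
    have hpoint : a (σ i) (c (σ i)) = f i := by rw [hac, hcinv i hi]
    rw [hψupdate, ← hpoint]
    exact h
  refine ⟨fun u => ψ (φ u), hψinj.comp φ.injective, fun u v huv => ?_⟩
  obtain ⟨hcard, himage⟩ := hσ u v huv
  obtain ⟨i, ⟨hi, h⟩ | ⟨hi, h⟩⟩ := hypercube_adj_cases (φ.toHom.map_adj huv)
  · have h : φ v = Function.update (φ u) i false := h
    rw [h] at hcard himage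
    change Γ.Adj (ψ (φ u)) (ψ (φ v))
    rw [h]
    exact hdown _ i hi hcard himage
  · have h : φ u = Function.update (φ v) i false := h
    have hcomm : nonzeroBits (φ u) (φ v) = nonzeroBits (φ v) (φ u) := by
      simp only [nonzeroBits, or_comm]
    rw [hcomm, h] at hcard himage
    change Γ.Adj (ψ (φ u)) (ψ (φ v))
    rw [h]
    exact (hdown _ i hi hcard himage).symm

/-- The vertices of `H` that lie on edges automatically land in the vertex set of `G'`; the isolated
ones can be moved there as soon as `G'` has enough vertices. -/
lemma isContained_coe_of_spanningCoe {V W : Type*} [Finite V] [Finite W] {H : SimpleGraph V}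
    {G : SimpleGraph W} (G' : G.Subgraph) (g : V → W) (hg : Function.Injective g)
    (hadj : ∀ u v, H.Adj u v → G'.Adj (g u) (g v)) (hcard : Nat.card V ≤ G'.verts.ncard) :
    H.IsContained G'.coe := by
  classical
  have := Fintype.ofFinite V
  have := Fintype.ofFinite W
  have hmaps (u : V) (hu : u ∈ H.support) : g u ∈ G'.verts := by
    obtain ⟨v, huv⟩ := hu
    exact (hadj u v huv).fst_mem
  have himage : g '' H.support ⊆ G'.verts := Set.image_subset_iff.2 hmaps
  obtain ⟨t, hgt, htG, ht⟩ := Set.exists_subsuperset_card_eq himage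
    (n := Nat.card V) ((Set.ncard_image_le).trans (Set.ncard_le_card _)) hcard
  obtain ⟨e, he⟩ := Set.MapsTo.exists_equiv_extend_of_card_eq (t := t.toFinset) (f := g)
    (s := H.support) (by rw [← Set.ncard_eq_toFinset_card', ht, Nat.card_eq_fintype_card])
    (fun u hu => by simpa using hgt ⟨u, hu, rfl⟩) hg.injOn
  refine ⟨⟨⟨fun u => ⟨e u, htG (Set.mem_toFinset.1 (e u).2)⟩, fun {u v} huv => ?_⟩, ?_⟩⟩
  · rw [SimpleGraph.Subgraph.coe_adj]
    simp only
    rw [he u ⟨v, huv⟩, he v ⟨u, huv.symm⟩]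
    exact hadj u v huv
  · intro u v huv
    exact e.injective (Subtype.ext (Subtype.mk.inj huv))

lemma ncard_edgeSet_le_ncard_verts_sq {W : Type*} [Finite W] {G : SimpleGraph W}
    (G' : G.Subgraph) : G'.edgeSet.ncard ≤ G'.verts.ncard ^ 2 := by
  rw [sq, ← Set.ncard_prod]
  refine (Set.ncard_le_ncard (t := (fun z : W × W => s(z.1, z.2)) '' (G'.verts ×ˢ G'.verts))
    ?_).trans Set.ncard_image_le
  intro e he
  induction e with | _ x y =>
  exact ⟨(x, y), ⟨he.fst_mem, he.snd_mem⟩, rfl⟩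

/-- A graph with a `k`-partite representation occurs in every subgraph of positive edge density of
a large hypercube. -/
theorem eventually_isContained_of_dense {V : Type*} {H : SimpleGraph V} {k : ℕ}
    (hH : HasPartiteRepresentation H k) {ε : ℝ} (hε : 0 < ε) :
    ∀ᶠ n : ℕ in Filter.atTop, ∀ G' : (hypercube n).Subgraph,
      ε * (hypercube n).edgeSet.ncard ≤ G'.edgeSet.ncard → H.IsContained G'.coe := by
  classical
  obtain ⟨l, φ, σ, hσ⟩ := hH
  have : Finite V := Finite.of_injective φ φ.injective
  -- Half of the pairs `(v, i)` are edges of the cube, so an edge density `ε` becomes `ε / 2`.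
  have hδ : 0 < ε / 2 := by positivity
  have hlarge := (tendsto_natCast_atTop_atTop (R := ℝ)).eventually_gt_atTop
    ((Nat.card V : ℝ) ^ 2 / (ε / 2))
  filter_upwards [eventually_exists_injective_blowup l k (pow_pos hδ k), hlarge,
    Filter.eventually_gt_atTop 0] with n hblow hn hn0 G' hG'
  have hcube : (2 : ℝ) * (hypercube n).edgeSet.ncard = n * 2 ^ n := by
    exact_mod_cast two_mul_ncard_edgeSet_hypercube n
  have hedges : ε / 2 * (n * 2 ^ n) ≤ G'.edgeSet.ncard := by
    rw [← hcube]; linarith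
  have hsum : (G'.edgeSet.ncard : ℝ) = ∑ v, (#(downDirections G'.spanningCoe v) : ℝ) := by
    rw [← SimpleGraph.Subgraph.edgeSet_spanningCoe,
      ncard_edgeSet_eq_sum_downDirections _ G'.spanningCoe_le, Nat.cast_sum]
  obtain ⟨S, hS⟩ := exists_base_of_dense hn0 k G'.spanningCoe hδ.le (hsum ▸ hedges)
  obtain ⟨a, ha, hstar⟩ := hblow _ hS
  obtain ⟨g, hg, hadj⟩ := exists_embedding_of_blowup φ σ hσ G'.spanningCoe S a ha hstar
  refine isContained_coe_of_spanningCoe G' g hg hadj ?_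
  have hsq : (Nat.card V : ℝ) ^ 2 ≤ (G'.verts.ncard : ℝ) ^ 2 := by
    have h1 : (G'.edgeSet.ncard : ℝ) ≤ (G'.verts.ncard : ℝ) ^ 2 := by
      exact_mod_cast ncard_edgeSet_le_ncard_verts_sq G'
    have h2 : ε / 2 * n ≤ ε / 2 * (n * 2 ^ n) := by
      gcongr
      exact le_mul_of_one_le_right (by positivity) (one_le_pow₀ (by norm_num))
    rw [div_lt_iff₀ hδ] at hn
    linarith
  exact_mod_cast (sq_le_sq₀ (Nat.cast_nonneg _) (Nat.cast_nonneg _)).1 hsq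
end

theorem theorem1 {V : Type*} (H : SimpleGraph V) (hH : ∃ k : ℕ, HasPartiteRepresentation H k) :
    (fun n : ℕ => (exNumber (hypercube n) H : ℝ)) =o[Filter.atTop]
      (fun n : ℕ => ((hypercube n).edgeSet.ncard : ℝ)) := by
  obtain ⟨k, hk⟩ := hH
  rw [Asymptotics.isLittleO_iff]
  intro ε hε
  filter_upwards [eventually_isContained_of_dense hk hε] with n hn
  rw [Real.norm_natCast, Real.norm_natCast]
  -- `csSup_le'` also covers the case without `H`-free subgraphs, where the supremum is `0`.
  refine (Nat.le_floor_iff (by positivity)).1 (csSup_le' ?_)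
  rintro m ⟨G', hfree, rfl⟩
  refine Nat.le_floor ?_
  by_contra! hlt
  exact hfree (hn G' hlt.le)
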